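/- Let $\Omega=\{0,1\}^{\mathbb Z}$. A (finite) pattern is a finite nonempty set of sites of $\mathbb Z$ with a symbol from $\{0,1\}$ at each of them, up to translation (the sites need not be consecutive). A Hamiltonian $H$ is an assignment of an energy $\Phi_H(p)\in\mathbb R$ to every pattern $p$; for a finite word $w$, $H(w)$ is the sum of the energies of all occurrences of patterns in $w$, and the energy density of $X\in\Omega$ is $\rho_H(X)=\liminf_{k\to\infty}\frac{H(X([-k,k]))}{2k+1}$, where $X([-k,k])=(X(i))_{i=-k}^{k}$. For a finite set $P$ of patterns and $\lambda>0$, a $(\lambda,P)$-perturbation of $H$ is a Hamiltonian $\widetilde H$ with $|\Phi_H(p)-\Phi_{\widetilde H}(p)|<\lambda$ for $p\in P$ and $\Phi_H(q)=\Phi_{\widetilde H}(q)$ for $q\notin P$. A configuration $X$ is a ground state of $H$ if $\liminf_{n\to\infty}\big(H(Y([-n,n]))-H(X([-n,n]))\big)\ge 0$ for every $Y\in\Omega$ that differs from $X$ at only finitely many sites. A ground state $X$ of $H$ is stable with respect to $\mathcal W\subseteq\Omega$ if for every finite set $P$ of patterns there is $\lambda>0$ such that $\rho_{\widetilde H}(X)\le\rho_{\widetilde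 H}(W)$ for every $(\lambda,P)$-perturbation $\widetilde H$ of $H$ and every $W\in\mathcal W$. For irrational $\varphi\in(0,1)$, a Sturmian word generated by $\varphi$ is an $X\in\Omega$ for which there are $x\in\mathbb R/\mathbb Z$ and an arc $I=[0,\varphi)$ or $I=(0,\varphi]$ of $\mathbb R/\mathbb Z$ such that $X(n)=0$ if $x+n\varphi\in I$ and $X(n)=1$ otherwise. A periodically Sturmian word generated by $\varphi$ is a periodic element of $\Omega$ whose period is a subword of a Sturmian word generated by $\varphi$; $\mathcal{PS}_\varphi$ is the set of these words. Let $\varphi\in(\frac34,1)$ be badly approximable, i.e. there is $c>0$ with $|\varphi-\frac pq|>\frac{c}{q^2}$ for all rationals $\frac pq$ ($q\geq 1$), and let $1<\alpha\le\frac32$. Let $F=\{k\in\mathbb N: k\varphi \bmod 1\in[1-\varphi,\varphi]\}$ be the set of forbidden distances and let $m$ be any natural number such that the word of $m$ consecutive $0$'s occurs in no Sturmian word generated by $\varphi$. Let $H_\alpha$ be the Hamiltonian that gives energy $\frac1{n^\alpha}$ to each pair of $1$'s at a forbidden distance $n\in F$, energy $1$ to the word of $m$ consecutive $0$'s, and energy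 $0$ to every other pattern. Then every Sturmian word $X$ generated by $\varphi$ is a ground state of $H_\alpha$ and is stable with respect to $\mathcal{PS}_\varphi$. -/

import Mathlib

namespace LatticeGas

open Filter Topology

/-- Bi-infinite words over the alphabet `{0, 1}`. -/
abbrev Config : Type := ℤ → Fin 2

/-- A finite pattern up to translation: the finite nonempty set of sites `ones ∪ zeros` together with
the symbol at each of its sites, translated so that its leftmost site is `0`. The set of sites
need not be an interval: the symbols at the other sites are unspecified. -/
@[ext]
structure Pattern where
  ones : Finset ℕ
  zeros : Finset ℕ
  disjoint : Disjoint ones zeros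
  leftmost : 0 ∈ ones ∪ zeros

/-- The pattern seen in `X` on the sites `i` and `i + j`, `j ∈ S`. -/
def patternAt (X : Config) (i : ℤ) (S : Finset ℕ) : Pattern where
  ones := (insert 0 S).filter (fun j => X (i + (j : ℤ)) = 1)
  zeros := (insert 0 S).filter (fun j => X (i + (j : ℤ)) = 0)
  disjoint := by
    rw [Finset.disjoint_left]
    intro j h₁ h₂
    have e₁ := (Finset.mem_filter.mp h₁).2
    have e₂ := (Finset.mem_filter.mp h₂).2
    rw [e₁] at e₂
    exact absurd e₂ (by decide)
  leftmost := by
    have h : X (i + ((0 : ℕ) : ℤ)) = 0 ∨ X (i + ((0 : ℕ) : ℤ)) = 1 := by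
      generalize X (i + ((0 : ℕ) : ℤ)) = s
      revert s
      decide
    rcases h with h | h
    · exact Finset.mem_union_right _ (Finset.mem_filter.mpr ⟨Finset.mem_insert_self _ _, h⟩)
    · exact Finset.mem_union_left _ (Finset.mem_filter.mpr ⟨Finset.mem_insert_self _ _, h⟩)

/-- A (translation-invariant, one-dimensional) Hamiltonian, given by the energy of every finite
pattern. -/
abbrev Hamiltonian : Type := Pattern → ℝ

/-- The joint energy `H(X([a,b]))` of all patterns in the finite word `X(a) ⋯ X(b)`. Each
occurrence of a pattern inside `[a,b]` is counted once, through its leftmost site `i` and the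
offsets `S` of its other sites. -/
noncomputable def energy (H : Hamiltonian) (X : Config) (a b : ℤ) : ℝ :=
  ∑ i ∈ Finset.Icc a b, ∑ S ∈ (Finset.Icc 1 (b - i).toNat).powerset, H (patternAt X i S)

/-- The energy density `liminf_k H(X([-k,k])) / (2k+1)`, as an extended real number. -/
noncomputable def energyDensity (H : Hamiltonian) (X : Config) : EReal :=
  liminf (fun k : ℕ => ((energy H X (-(k : ℤ)) (k : ℤ) / (2 * (k : ℝ) + 1) : ℝ) : EReal)) atTop

/-- `X` is a ground-state configuration of `H`: no change of `X` at finitely many sites lowers the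
energy, that is, `liminf_n (H(Y([-n,n])) - H(X([-n,n]))) ≥ 0` for every `Y` that differs from `X`
at finitely many sites only. -/
def IsGroundState (H : Hamiltonian) (X : Config) : Prop :=
  ∀ Y : Config, {i : ℤ | Y i ≠ X i}.Finite → ∀ ε : ℝ, 0 < ε →
    ∀ᶠ n : ℕ in atTop, energy H X (-(n : ℤ)) (n : ℤ) ≤ energy H Y (-(n : ℤ)) (n : ℤ) + ε

/-- `H'` is a `(lam, P)`-perturbation of `H`. -/
def IsPerturbation (lam : ℝ) (P : Finset Pattern) (H H' : Hamiltonian) : Prop :=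
  (∀ p ∈ P, |H p - H' p| < lam) ∧ ∀ q, q ∉ P → H q = H' q

/-- `X` is a ground-state configuration of `H` that is stable with respect to the set `W` of
bi-infinite words, against small perturbations of finite range. -/
def IsStableGroundState (H : Hamiltonian) (X : Config) (W : Set Config) : Prop :=
  IsGroundState H X ∧
    ∀ P : Finset Pattern, ∃ lam : ℝ, 0 < lam ∧
      ∀ H' : Hamiltonian, IsPerturbation lam P H H' →
        ∀ Y ∈ W, energyDensity H' X ≤ energyDensity H' Y

/-- There is `c > 0` with `|φ - p/q| > c/q²` for all rationals `p/q`. -/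
def BadlyApproximable (φ : ℝ) : Prop :=
  ∃ c : ℝ, 0 < c ∧ ∀ (p : ℤ) (q : ℕ), 0 < q → c / (q : ℝ) ^ 2 < |φ - (p : ℝ) / (q : ℝ)|

/-- For `φ` in `(0,1)`: `X` is a Sturmian word generated by `φ`, that is, for some `x`, the symbol
`X n` is `0` exactly when `x + nφ mod 1` lies in the arc `P`, where `P = [0,φ)` or `P = (0,φ]`. -/
def IsSturmian (φ : ℝ) (X : Config) : Prop :=
  ∃ x : ℝ, (∀ n : ℤ, X n = 0 ↔ Int.fract (x + (n : ℝ) * φ) ∈ Set.Ico 0 φ) ∨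
    (∀ n : ℤ, X n = 0 ↔ Int.fract (x + (n : ℝ) * φ) ∈ Set.Ioc 0 φ)

/-- The periodically Sturmian words generated by `φ`: periodic words whose period is a subword of
a Sturmian word generated by `φ`. -/
def periodicallySturmian (φ : ℝ) : Set Config :=
  {Y | ∃ k : ℕ, 0 < k ∧ (∀ i : ℤ, Y (i + (k : ℤ)) = Y i) ∧
    ∃ Z : Config, IsSturmian φ Z ∧
      ∃ a b : ℤ, ∀ j : ℕ, j < k → Y (a + (j : ℤ)) = Z (b + (j : ℤ))}

/-- The set of forbidden distances: the natural numbers `k` with `kφ mod 1` in `[1-φ, φ]`. -/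
def forbiddenDistances (φ : ℝ) : Set ℕ :=
  {k | Int.fract ((k : ℝ) * φ) ∈ Set.Icc (1 - φ) φ}

/-- The word `0 ⋯ 0` of length `m` is forbidden: it occurs in no Sturmian word generated
by `φ`. -/
def ForbiddenZeros (φ : ℝ) (m : ℕ) : Prop :=
  ∀ Z : Config, IsSturmian φ Z → ¬ ∃ i : ℤ, ∀ j : ℕ, j < m → Z (i + (j : ℤ)) = 0

open Classical in
/-- The Hamiltonian `H_α`: energy `1` for the word `0 ⋯ 0` of length `m`, energy `1/n^α` for a pair
of `1`s at a forbidden distance `n`, and energy `0` for every other pattern. (For the pattern with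
`ones = {0, n}`, the number `p.ones.sup id` is `n`.) -/
noncomputable def sturmianHamiltonian (φ α : ℝ) (m : ℕ) : Hamiltonian := fun p =>
  if p.ones = ∅ ∧ p.zeros = Finset.range m then 1
  else if p.zeros = ∅ ∧ ∃ n ∈ forbiddenDistances φ, p.ones = {0, n} then
    1 / ((p.ones.sup id : ℕ) : ℝ) ^ α
  else 0

end LatticeGas

/-!
The Hamiltonian is nonnegative, and it vanishes on Sturmian words: two symbols `1` of such a word
lie over an arc of length `1 - φ`, so their distance `n` has `nφ` closer than `1 - φ` to an integer.
Hence Sturmian words are ground states, and only stability has to be proved.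

A perturbation `D` supported on finitely many patterns changes energy densities through the
frequencies of these patterns. In a Sturmian word the sites at which a pattern occurs are the
visits of a rotation orbit to a cylinder set, and the indicator of this set is a linear combination
of indicators of arcs `[0, 1 - {jφ})`, `j ∈ ℤ` (`letter_mem_adjoin`; these arcs are nested, so the
span of their indicators is an algebra). Such an indicator is, up to a constant, a coboundary
(`rotArc_eq`), so the discrepancy of the pattern is bounded, uniformly in the Sturmian word
(`exists_hasDiscrepancy_of_isSturmian`). If `W` has a Sturmian period of length `k`, the frequency
of the pattern in `W` therefore differs from the Sturmian one by `O(1 / k)`, and `D` can lower the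
energy of `W` by at most `O(sup |D|)` per period.

Against this stands an energy of `W` per period that is bounded below independently of `W` and `k`
(`exists_le_period_energy`). If `W` contains `m` consecutive `0`s this is clear. Otherwise it has at
least `k / m` symbols `1` per period. By Dirichlet's theorem some `q ≤ Q`, with `Q` depending on `φ`
only, makes the distance `d` of `qkφ` from the integers small, while bad approximability gives
`d ≥ c / (Qk)`. About `1 / d` of the numbers `i ≤ 1 / d` have `i d ∈ [2 - 2φ, 2φ - 1]`, an interval of
positive length since `φ > 3 / 4`, and for each of them any two `1`s taken from two periods that are
`i q` periods apart are at a forbidden distance, which is at most `2Qk / d`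
(`card_mul_le_sum_pairPattern`). Their total energy per period is of order at least
`(k / m)² · (1 / d) · (k / d) ^ (-3 / 2)`, that is `√(k d) / m²`, which is bounded below since `k d` is.
-/

namespace LatticeGas

open Filter Topology

/-! ### Occurrences of patterns and the energy of finite-range Hamiltonians -/

lemma eq_one_iff_ne_zero (a : Fin 2) : a = 1 ↔ a ≠ 0 := by
  revert a; decide

namespace Pattern

/-- The largest offset of a site of the pattern. -/
def width (p : Pattern) : ℕ := (p.ones ∪ p.zeros).sup id

/-- The pattern `p` occurs in `X` with its leftmost site at `i`. -/
def OccursAt (p : Pattern) (X : Config) (i : ℤ) : Prop :=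
  (∀ j ∈ p.ones, X (i + (j : ℤ)) = 1) ∧ ∀ j ∈ p.zeros, X (i + (j : ℤ)) = 0

open Classical in
/-- The indicator of the sites at which `p` occurs in `X`. -/
noncomputable def occ (p : Pattern) (X : Config) (i : ℤ) : ℝ :=
  if p.OccursAt X i then 1 else 0

lemma occ_nonneg (p : Pattern) (X : Config) (i : ℤ) : 0 ≤ p.occ X i := by
  unfold occ; split_ifs <;> norm_num

lemma occ_le_one (p : Pattern) (X : Config) (i : ℤ) : p.occ X i ≤ 1 := by
  unfold occ; split_ifs <;> norm_num

lemma le_width {p : Pattern} {j : ℕ} (h : j ∈ p.ones ∪ p.zeros) : j ≤ p.width :=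
  Finset.le_sup (f := id) h

lemma occ_congr {p : Pattern} {X Y : Config} {i i' : ℤ}
    (h : ∀ j : ℕ, j ≤ p.width → X (i + (j : ℤ)) = Y (i' + (j : ℤ))) :
    p.occ X i = p.occ Y i' := by
  have : p.OccursAt X i ↔ p.OccursAt Y i' := by
    unfold OccursAt
    refine and_congr (forall₂_congr fun j hj => ?_) (forall₂_congr fun j hj => ?_)
    · rw [h j (le_width (Finset.mem_union_left _ hj))]
    · rw [h j (le_width (Finset.mem_union_right _ hj))]
  classical exact if_congr this rfl rfl

end Pattern

lemma patternAt_eq_iff {X : Config} {i : ℤ} {S : Finset ℕ} {p : Pattern} (hS : 0 ∉ S) :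
    patternAt X i S = p ↔ S = (p.ones ∪ p.zeros).erase 0 ∧ p.OccursAt X i := by
  constructor
  · rintro rfl
    refine ⟨?_, ?_, ?_⟩
    · have h : (patternAt X i S).ones ∪ (patternAt X i S).zeros = insert 0 S := by
        ext j
        simp only [patternAt, Finset.mem_union, Finset.mem_filter, eq_one_iff_ne_zero]
        tauto
      rw [h, Finset.erase_insert hS]
    · intro j hj
      exact (Finset.mem_filter.mp hj).2
    · intro j hj
      exact (Finset.mem_filter.mp hj).2
  · rintro ⟨rfl, h1, h0⟩
    have e : insert 0 ((p.ones ∪ p.zeros).erase 0) = p.ones ∪ p.zeros :=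
      Finset.insert_erase p.leftmost
    ext j
    · simp only [patternAt, e, Finset.mem_filter, Finset.mem_union]
      constructor
      · rintro ⟨h | h, hj⟩
        · exact h
        · rw [h0 j h] at hj
          exact absurd hj (by decide)
      · intro h
        exact ⟨Or.inl h, h1 j h⟩
    · simp only [patternAt, e, Finset.mem_filter, Finset.mem_union]
      constructor
      · rintro ⟨h | h, hj⟩
        · rw [h1 j h] at hj
          exact absurd hj (by decide)
        · exact h
      · intro h
        exact ⟨Or.inr h, h0 j h⟩

lemma zero_notMem_of_mem_powerset {n : ℕ} {S : Finset ℕ} (h : S ∈ (Finset.Icc 1 n).powerset) :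
    0 ∉ S := fun h0 => by
  have := Finset.mem_Icc.mp (Finset.mem_powerset.mp h h0)
  omega

open Classical in
/-- The occurrences of `p` with leftmost site `i` inside a word ending `n` sites to the right. -/
lemma sum_powerset_patternAt (p : Pattern) (X : Config) (i : ℤ) (n : ℕ) :
    ∑ S ∈ (Finset.Icc 1 n).powerset, (if patternAt X i S = p then (1 : ℝ) else 0) =
      if p.width ≤ n then p.occ X i else 0 := by
  have h1 : ∀ S ∈ (Finset.Icc 1 n).powerset, (if patternAt X i S = p then (1 : ℝ) else 0) =
      if S = (p.ones ∪ p.zeros).erase 0 then p.occ X i else 0 := by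
    intro S hS
    simp only [patternAt_eq_iff (zero_notMem_of_mem_powerset hS), Pattern.occ]
    split_ifs <;> tauto
  rw [Finset.sum_congr rfl h1, Finset.sum_ite_eq']
  have h2 : (p.ones ∪ p.zeros).erase 0 ∈ (Finset.Icc 1 n).powerset ↔ p.width ≤ n := by
    rw [Finset.mem_powerset, Pattern.width, Finset.sup_le_iff]
    constructor
    · intro h j hj
      rcases Nat.eq_zero_or_pos j with rfl | hj0
      · exact Nat.zero_le _
      · exact (Finset.mem_Icc.mp (h (Finset.mem_erase.mpr ⟨hj0.ne', hj⟩))).2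
    · intro h j hj
      rw [Finset.mem_erase] at hj
      exact Finset.mem_Icc.mpr ⟨Nat.one_le_iff_ne_zero.mpr hj.1, h j hj.2⟩
  simp only [h2]

lemma energy_eq_of_support {D : Hamiltonian} {P : Finset Pattern} (hD : ∀ p, p ∉ P → D p = 0)
    (X : Config) (a b : ℤ) :
    energy D X a b = ∑ p ∈ P, D p * ∑ i ∈ Finset.Icc a (b - p.width), p.occ X i := by
  classical
  have h1 : ∀ q, D q = ∑ p ∈ P, D p * (if q = p then (1 : ℝ) else 0) := by
    intro q
    simp only [mul_ite, mul_one, mul_zero, Finset.sum_ite_eq]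
    split_ifs with h
    · rfl
    · exact hD q h
  have h2 : energy D X a b = ∑ i ∈ Finset.Icc a b, ∑ p ∈ P,
      D p * (if p.width ≤ (b - i).toNat then p.occ X i else 0) := by
    unfold energy
    refine Finset.sum_congr rfl fun i _ => ?_
    rw [Finset.sum_congr rfl fun S _ => h1 (patternAt X i S), Finset.sum_comm]
    refine Finset.sum_congr rfl fun p _ => ?_
    rw [← Finset.mul_sum, sum_powerset_patternAt]
  rw [h2, Finset.sum_comm]
  refine Finset.sum_congr rfl fun p _ => ?_
  rw [← Finset.mul_sum, ← Finset.sum_filter]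
  congr 2
  ext i
  simp only [Finset.mem_filter, Finset.mem_Icc]
  omega

lemma energy_add (H D : Hamiltonian) (X : Config) (a b : ℤ) :
    energy (fun p => H p + D p) X a b = energy H X a b + energy D X a b := by
  simp only [energy, Finset.sum_add_distrib]

lemma energy_mono {H D : Hamiltonian} (h : ∀ p, H p ≤ D p) (X : Config) (a b : ℤ) :
    energy H X a b ≤ energy D X a b :=
  Finset.sum_le_sum fun _ _ => Finset.sum_le_sum fun _ _ => h _

/-! ### Sequences with bounded discrepancy -/

/-- The sums of `h` over all intervals of length `n` are within `C` of `n * μ`. -/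
def HasDiscrepancy (h : ℤ → ℝ) (μ C : ℝ) : Prop :=
  ∀ (a : ℤ) (n : ℕ), |∑ j ∈ Finset.range n, h (a + (j : ℤ)) - n * μ| ≤ C

lemma sum_Icc_eq_sum_range (h : ℤ → ℝ) (a b : ℤ) :
    ∑ i ∈ Finset.Icc a b, h i = ∑ j ∈ Finset.range (b + 1 - a).toNat, h (a + (j : ℤ)) := by
  refine Finset.sum_nbij' (fun i => (i - a).toNat) (fun j => a + (j : ℤ)) ?_ ?_ ?_ ?_ ?_
  · intro i hi
    simp only [Finset.mem_Icc, Finset.mem_range] at *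
    omega
  · intro i hi
    simp only [Finset.mem_Icc, Finset.mem_range] at *
    omega
  · intro i hi
    simp only [Finset.mem_Icc] at *
    omega
  · intro i hi
    simp
  · intro i hi
    simp only [Finset.mem_Icc] at hi
    congr 1
    omega

lemma HasDiscrepancy.sum_Icc {h : ℤ → ℝ} {μ C : ℝ} (hh : HasDiscrepancy h μ C) (K w : ℕ) :
    |∑ i ∈ Finset.Icc (-(K : ℤ)) ((K : ℤ) - w), h i - (2 * (K : ℝ) + 1) * μ| ≤ C + w * |μ| := by
  rw [sum_Icc_eq_sum_range]
  set n := ((K : ℤ) - w + 1 - (-(K : ℤ))).toNat with hn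
  have h1 : |(n : ℝ) - (2 * (K : ℝ) + 1)| ≤ w := by
    have h2 : |(n : ℤ) - (2 * (K : ℤ) + 1)| ≤ w := by
      rw [abs_le]
      omega
    exact_mod_cast h2
  calc |∑ j ∈ Finset.range n, h (-(K : ℤ) + (j : ℤ)) - (2 * (K : ℝ) + 1) * μ|
      = |(∑ j ∈ Finset.range n, h (-(K : ℤ) + (j : ℤ)) - n * μ)
          + ((n : ℝ) - (2 * (K : ℝ) + 1)) * μ| := by
        congr 1
        ring
    _ ≤ _ := (abs_add_le _ _).trans (add_le_add (hh _ _) (by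
        rw [abs_mul]
        exact mul_le_mul_of_nonneg_right h1 (abs_nonneg _)))

/-- A Hamiltonian supported on finitely many patterns has an honest limiting energy density in a
word in which these patterns have bounded discrepancy. -/
lemma tendsto_energy_div {D : Hamiltonian} {P : Finset Pattern} (hD : ∀ p, p ∉ P → D p = 0)
    {X : Config} {μ C : Pattern → ℝ} (h : ∀ p ∈ P, HasDiscrepancy (p.occ X) (μ p) (C p)) :
    Tendsto (fun K : ℕ => energy D X (-(K : ℤ)) (K : ℤ) / (2 * (K : ℝ) + 1)) atTop
      (𝓝 (∑ p ∈ P, D p * μ p)) := by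
  set B := ∑ p ∈ P, |D p| * (C p + p.width * |μ p|) with hB
  have hb : ∀ K : ℕ, |energy D X (-(K : ℤ)) (K : ℤ) - (2 * (K : ℝ) + 1) * ∑ p ∈ P, D p * μ p|
      ≤ B := by
    intro K
    rw [energy_eq_of_support hD, Finset.mul_sum, ← Finset.sum_sub_distrib]
    refine (Finset.abs_sum_le_sum_abs _ _).trans (Finset.sum_le_sum fun p hp => ?_)
    calc _ = |D p * (∑ i ∈ Finset.Icc (-(K : ℤ)) ((K : ℤ) - p.width), p.occ X i
            - (2 * (K : ℝ) + 1) * μ p)| := by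
          congr 1
          ring
      _ ≤ _ := by
          rw [abs_mul]
          exact mul_le_mul_of_nonneg_left ((h p hp).sum_Icc K p.width) (abs_nonneg _)
  have h0 : Tendsto (fun K : ℕ => B / (2 * (K : ℝ) + 1)) atTop (𝓝 0) := by
    refine Tendsto.div_atTop tendsto_const_nhds ?_
    exact tendsto_atTop_add_const_right _ _
      (Tendsto.const_mul_atTop (by norm_num) tendsto_natCast_atTop_atTop)
  rw [tendsto_iff_norm_sub_tendsto_zero]
  refine squeeze_zero (fun _ => norm_nonneg _) (fun K => ?_) h0
  have hK : (0 : ℝ) < 2 * (K : ℝ) + 1 := by positivity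
  rw [Real.norm_eq_abs, le_div_iff₀ hK]
  calc _ = |(energy D X (-(K : ℤ)) (K : ℤ) / (2 * (K : ℝ) + 1) - ∑ p ∈ P, D p * μ p)
          * (2 * (K : ℝ) + 1)| := by rw [abs_mul, abs_of_pos hK]
    _ = |energy D X (-(K : ℤ)) (K : ℤ) - (2 * (K : ℝ) + 1) * ∑ p ∈ P, D p * μ p| := by
        congr 1
        field_simp
    _ ≤ B := hb K

lemma sum_range_periodic {h : ℤ → ℝ} {k : ℕ} (hh : Function.Periodic h (k : ℤ)) (a b : ℤ) :
    ∑ j ∈ Finset.range k, h (a + (j : ℤ)) = ∑ j ∈ Finset.range k, h (b + (j : ℤ)) := by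
  have step : ∀ a : ℤ, ∑ j ∈ Finset.range k, h (a + 1 + (j : ℤ)) =
      ∑ j ∈ Finset.range k, h (a + (j : ℤ)) := by
    intro a
    have h1 := Finset.sum_range_succ (fun j : ℕ => h (a + (j : ℤ))) k
    rw [Finset.sum_range_succ', hh a] at h1
    simp only [Nat.cast_zero, add_zero, add_left_inj] at h1
    rw [← h1]
    refine Finset.sum_congr rfl fun j _ => ?_
    congr 1
    push_cast
    ring
  have all : ∀ a : ℤ, ∑ j ∈ Finset.range k, h (a + (j : ℤ)) =
      ∑ j ∈ Finset.range k, h (0 + (j : ℤ)) := by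
    intro a
    induction a using Int.induction_on with
    | zero => rfl
    | succ i ih => rw [step, ih]
    | pred i ih => rw [← ih, ← step (-(i : ℤ) - 1), sub_add_cancel]
  rw [all a, all b]

/-- The mean of a periodic sequence is its average over any one period. -/
lemma exists_hasDiscrepancy_of_periodic {h : ℤ → ℝ} {k : ℕ} (hk : 0 < k)
    (hh : Function.Periodic h (k : ℤ)) (b : ℤ) :
    ∃ C, HasDiscrepancy h ((∑ j ∈ Finset.range k, h (b + (j : ℤ))) / k) C := by
  set μ := (∑ j ∈ Finset.range k, h (b + (j : ℤ))) / k with hμ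
  have hk' : (k : ℝ) ≠ 0 := by positivity
  let f : ℤ → ℕ → ℝ := fun a n => ∑ j ∈ Finset.range n, h (a + (j : ℤ)) - n * μ
  have fa : ∀ n, Function.Periodic (fun a => f a n) (k : ℤ) := by
    intro n a
    simp only [f]
    congr 1
    refine Finset.sum_congr rfl fun j _ => ?_
    rw [add_right_comm]
    exact hh _
  have fn : ∀ a, Function.Periodic (f a) k := by
    intro a n
    have : ∑ j ∈ Finset.range k, h (a + ((n + j : ℕ) : ℤ)) = k * μ := by
      rw [hμ, mul_div_cancel₀ _ hk', ← sum_range_periodic hh (a + n) b]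
      refine Finset.sum_congr rfl fun j _ => ?_
      congr 1
      push_cast
      ring
    simp only [f]
    rw [Finset.sum_range_add, this]
    push_cast
    ring
  refine ⟨∑ i ∈ Finset.range k, ∑ n ∈ Finset.range k, |f i n|, fun a n => ?_⟩
  obtain ⟨i, hi⟩ : ∃ i : ℕ, a % (k : ℤ) = i :=
    ⟨(a % (k : ℤ)).toNat, (Int.toNat_of_nonneg (Int.emod_nonneg _ (by omega))).symm⟩
  have hik : i < k := by
    have := Int.emod_lt_of_pos a (show (0 : ℤ) < k by omega)
    omega
  have e : f a n = f i (n % k) := by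
    rw [(fn i).map_mod_nat n, ← hi]
    have h := (fa n).sub_int_mul_eq (x := a) (a / (k : ℤ))
    have e' : a - a / (k : ℤ) * (k : ℤ) = a % (k : ℤ) := by
      rw [Int.emod_def, mul_comm]
    rw [Int.cast_id, e'] at h
    exact h.symm
  change |f a n| ≤ _
  rw [e]
  refine le_trans ?_ (Finset.single_le_sum
    (f := fun i : ℕ => ∑ n ∈ Finset.range k, |f i n|)
    (fun _ _ => Finset.sum_nonneg fun _ _ => abs_nonneg _) (Finset.mem_range.mpr hik))
  exact Finset.single_le_sum (f := fun n => |f i n|) (fun _ _ => abs_nonneg _)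
    (Finset.mem_range.mpr (Nat.mod_lt _ hk))

/-! ### Bounded discrepancy of patterns in Sturmian words -/

/-- The indicator of the arc `[0, 1 - {jφ})` of the circle, as a function on the line. Its right
endpoint is the point `-jφ` of the circle, and the arc is the whole circle for `j = 0`. -/
noncomputable def rotArc (φ : ℝ) (j : ℤ) (t : ℝ) : ℝ :=
  if Int.fract t < 1 - Int.fract ((j : ℝ) * φ) then 1 else 0

/-- Up to a constant, the indicator of an arc whose length is a multiple of `φ` is a coboundary
of the rotation by `φ`. -/
lemma rotArc_eq (φ : ℝ) (j : ℤ) (t : ℝ) :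
    rotArc φ j t = Int.fract (t + j * φ) - Int.fract t - Int.fract ((j : ℝ) * φ) + 1 := by
  have h1 := Int.fract_nonneg t
  have h2 := Int.fract_nonneg ((j : ℝ) * φ)
  have h3 := Int.fract_lt_one t
  have h4 := Int.fract_lt_one ((j : ℝ) * φ)
  unfold rotArc
  split_ifs with h
  · have : Int.fract (t + j * φ) = Int.fract t + Int.fract ((j : ℝ) * φ) := by
      rw [Int.fract_eq_iff]
      refine ⟨by linarith, by linarith, ⌊t⌋ + ⌊(j : ℝ) * φ⌋, ?_⟩
      push_cast
      unfold Int.fract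
      ring
    linarith
  · have : Int.fract (t + j * φ) = Int.fract t + Int.fract ((j : ℝ) * φ) - 1 := by
      rw [Int.fract_eq_iff]
      refine ⟨by linarith, by linarith, ⌊t⌋ + ⌊(j : ℝ) * φ⌋ + 1, ?_⟩
      push_cast
      unfold Int.fract
      ring
    linarith

/-- Arcs starting at `0` are nested, so their indicators form a monoid. -/
lemma rotArc_mul (φ : ℝ) (i j : ℤ) :
    rotArc φ i * rotArc φ j = rotArc φ i ∨ rotArc φ i * rotArc φ j = rotArc φ j := by
  rcases le_total (1 - Int.fract ((i : ℝ) * φ)) (1 - Int.fract ((j : ℝ) * φ)) with h | h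
  · left
    ext t
    simp only [Pi.mul_apply, rotArc]
    by_cases hi : Int.fract t < 1 - Int.fract ((i : ℝ) * φ)
    · simp [hi, hi.trans_le h]
    · simp [hi]
  · right
    ext t
    simp only [Pi.mul_apply, rotArc]
    by_cases hj : Int.fract t < 1 - Int.fract ((j : ℝ) * φ)
    · simp [hj, hj.trans_le h]
    · simp [hj]

lemma rotArc_zero (φ : ℝ) : rotArc φ 0 = 1 := by
  ext t
  simp [rotArc, Int.fract_lt_one]

/-- The indicators of the arcs `[0, 1 - {jφ})`, as a submonoid of the functions on the line. -/
def rotArcs (φ : ℝ) : Submonoid (ℝ → ℝ) where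
  carrier := Set.range (rotArc φ)
  one_mem' := ⟨0, rotArc_zero φ⟩
  mul_mem' := by
    rintro _ _ ⟨i, rfl⟩ ⟨j, rfl⟩
    rcases rotArc_mul φ i j with h | h <;> rw [h] <;> exact Set.mem_range_self _

/-- The sums of `f` over orbits of length `n` of the rotation by `φ` are within a bounded distance
of a multiple of `n`. -/
def BoundedDiscrepancy (φ : ℝ) (f : ℝ → ℝ) : Prop :=
  ∃ μ C : ℝ, ∀ (y : ℝ) (n : ℕ), |∑ i ∈ Finset.range n, f (y + i * φ) - n * μ| ≤ C

lemma exists_abs_sum_fract_sub_le (φ : ℝ) (j : ℤ) : ∃ C : ℝ, ∀ (y : ℝ) (n : ℕ),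
    |∑ i ∈ Finset.range n, (Int.fract (y + i * φ + j * φ) - Int.fract (y + i * φ))| ≤ C := by
  have key : ∀ (j : ℤ) (y : ℝ) (n : ℕ),
      |∑ i ∈ Finset.range n, (Int.fract (y + i * φ + (j + 1 : ℤ) * φ) -
        Int.fract (y + i * φ + j * φ))| ≤ 1 := by
    intro j y n
    have h := Finset.sum_range_sub (fun i : ℕ => Int.fract (y + i * φ + j * φ)) n
    have e : ∀ i : ℕ, y + i * φ + ((j + 1 : ℤ) : ℝ) * φ = y + ((i + 1 : ℕ) : ℝ) * φ + j * φ := by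
      intro i
      push_cast
      ring
    simp only [e]
    rw [h]
    have h1 := Int.fract_nonneg (y + (n : ℝ) * φ + j * φ)
    have h2 := Int.fract_lt_one (y + (n : ℝ) * φ + j * φ)
    have h3 := Int.fract_nonneg (y + ((0 : ℕ) : ℝ) * φ + j * φ)
    have h4 := Int.fract_lt_one (y + ((0 : ℕ) : ℝ) * φ + j * φ)
    rw [abs_le]
    constructor <;> linarith
  induction j using Int.induction_on with
  | zero => exact ⟨0, fun y n => by simp⟩
  | succ j ih =>
    obtain ⟨C, hC⟩ := ih
    refine ⟨C + 1, fun y n => ?_⟩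
    refine le_trans ?_ ((abs_add_le _ _).trans (add_le_add (hC y n) (key j y n)))
    rw [← Finset.sum_add_distrib]
    refine le_of_eq (congrArg _ (Finset.sum_congr rfl fun i _ => ?_))
    push_cast
    ring
  | pred j ih =>
    obtain ⟨C, hC⟩ := ih
    refine ⟨C + 1, fun y n => ?_⟩
    refine le_trans ?_ ((abs_sub _ _).trans (add_le_add (hC y n) (key (-(j : ℤ) - 1) y n)))
    rw [← Finset.sum_sub_distrib]
    refine le_of_eq (congrArg _ (Finset.sum_congr rfl fun i _ => ?_))
    rw [sub_add_cancel]
    ring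

lemma boundedDiscrepancy_rotArc (φ : ℝ) (j : ℤ) : BoundedDiscrepancy φ (rotArc φ j) := by
  obtain ⟨C, hC⟩ := exists_abs_sum_fract_sub_le φ j
  refine ⟨1 - Int.fract ((j : ℝ) * φ), C, fun y n => ?_⟩
  refine le_trans (le_of_eq (congrArg _ ?_)) (hC y n)
  simp only [rotArc_eq, Finset.sum_add_distrib, Finset.sum_sub_distrib, Finset.sum_const,
    Finset.card_range, nsmul_eq_mul]
  ring

lemma boundedDiscrepancy_of_mem_adjoin {φ : ℝ} {f : ℝ → ℝ}
    (hf : f ∈ Algebra.adjoin ℝ (rotArcs φ : Set (ℝ → ℝ))) : BoundedDiscrepancy φ f := by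
  rw [← Subalgebra.mem_toSubmodule, Algebra.adjoin_eq_span, Submonoid.closure_eq] at hf
  induction hf using Submodule.span_induction with
  | mem f hf =>
    obtain ⟨j, rfl⟩ := hf
    exact boundedDiscrepancy_rotArc φ j
  | zero => exact ⟨0, 0, fun y n => by simp⟩
  | add f g _ _ hf hg =>
    obtain ⟨μ, C, h⟩ := hf
    obtain ⟨ν, D, h'⟩ := hg
    refine ⟨μ + ν, C + D, fun y n => ?_⟩
    refine le_trans (le_of_eq (congrArg _ ?_))
      ((abs_add_le _ _).trans (add_le_add (h y n) (h' y n)))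
    simp only [Pi.add_apply, Finset.sum_add_distrib]
    ring
  | smul a f _ hf =>
    obtain ⟨μ, C, h⟩ := hf
    refine ⟨a * μ, |a| * C, fun y n => ?_⟩
    refine le_trans (le_of_eq ?_) (mul_le_mul_of_nonneg_left (h y n) (abs_nonneg a))
    rw [← abs_mul]
    congr 1
    simp only [Pi.smul_apply, smul_eq_mul, ← Finset.mul_sum]
    ring

lemma letter_mem_adjoin {φ : ℝ} (h0 : 0 < φ) (h1 : φ < 1) (j : ℕ) :
    (fun t : ℝ => if Int.fract (t + j * φ) < φ then (1 : ℝ) else 0) ∈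
      Algebra.adjoin ℝ (rotArcs φ : Set (ℝ → ℝ)) := by
  set A := Algebra.adjoin ℝ (rotArcs φ : Set (ℝ → ℝ))
  have e : (fun t : ℝ => if Int.fract (t + j * φ) < φ then (1 : ℝ) else 0) =
      rotArc φ ((j : ℤ) - 1) - rotArc φ (j : ℤ) + algebraMap ℝ (ℝ → ℝ)
        (φ + Int.fract ((((j : ℤ) - 1 : ℤ) : ℝ) * φ) - Int.fract (((j : ℤ) : ℝ) * φ)) := by
    ext t
    have hφ : Int.fract (-1 * φ) = 1 - φ := by
      rw [Int.fract_eq_iff]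
      exact ⟨by linarith, by linarith, -1, by push_cast; ring⟩
    have h := rotArc_eq φ (-1) (t + j * φ)
    simp only [rotArc, Int.cast_neg, Int.cast_one, hφ, sub_sub_cancel] at h
    simp only [Pi.add_apply, Pi.sub_apply, Pi.algebraMap_apply, Algebra.algebraMap_self,
      RingHom.id_apply, rotArc_eq]
    have e1 : t + (((j : ℤ) - 1 : ℤ) : ℝ) * φ = t + j * φ + -1 * φ := by
      push_cast
      ring
    rw [e1, h]
    push_cast
    ring
  rw [e]
  exact A.add_mem (A.sub_mem (Algebra.subset_adjoin ⟨_, rfl⟩) (Algebra.subset_adjoin ⟨_, rfl⟩))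
    (A.algebraMap_mem _)

/-- A finite part of a Sturmian word for an arc `(0, φ]` is also one for the arc `[0, φ)`. -/
lemma IsSturmian.exists_Ico {φ : ℝ} (h1 : φ < 1) {X : Config} (hX : IsSturmian φ X)
    (s : Finset ℤ) : ∃ x : ℝ, ∀ n ∈ s, X n = 0 ↔ Int.fract (x + (n : ℝ) * φ) < φ := by
  obtain ⟨x, hx | hx⟩ := hX
  · exact ⟨x, fun n _ => by rw [hx n]; simp [Int.fract_nonneg]⟩
  -- moving the base point slightly to the left does the same as exchanging the endpoints
  have key : ∀ n ∈ s, ∀ᶠ ε : ℝ in 𝓝[>] 0,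
      (X n = 0 ↔ Int.fract (x - ε + (n : ℝ) * φ) < φ) := by
    intro n _
    set y := x + (n : ℝ) * φ with hy
    have e : ∀ ε : ℝ, x - ε + (n : ℝ) * φ = y - ε := fun ε => by rw [hy]; ring
    have f0 := Int.fract_nonneg y
    have f1 := Int.fract_lt_one y
    have fl : Int.fract y = y - ⌊y⌋ := rfl
    simp only [hx n, e, ← hy]
    rcases f0.eq_or_lt with h | h
    · filter_upwards [Ioo_mem_nhdsGT (show (0 : ℝ) < 1 - φ by linarith)] with ε hε
      have : Int.fract (y - ε) = 1 - ε ∨ 1 ≤ ε := by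
        rcases lt_or_ge ε 1 with h' | h'
        · left
          rw [Int.fract_eq_iff]
          refine ⟨by linarith, by linarith [hε.1], ⌊y⌋ - 1, ?_⟩
          push_cast
          linarith
        · exact Or.inr h'
      constructor
      · intro h'
        exact absurd h'.1 (by rw [← h]; exact lt_irrefl _)
      · intro h'
        exfalso
        rcases this with h3 | h3
        · linarith [hε.2]
        · linarith [hε.2, Int.fract_nonneg (y - ε), h'.trans_le (le_refl φ)]
    · have hm : (0 : ℝ) < min (Int.fract y) (if Int.fract y ≤ φ then 1 else Int.fract y - φ) := by
        refine lt_min h ?_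
        split_ifs with h'
        · norm_num
        · linarith
      filter_upwards [Ioo_mem_nhdsGT hm] with ε hε
      have hε1 := hε.2.trans_le (min_le_left _ _)
      have hε2 := hε.2.trans_le (min_le_right _ _)
      have : Int.fract (y - ε) = Int.fract y - ε := by
        rw [Int.fract_eq_iff]
        exact ⟨by linarith, by linarith [hε.1], ⌊y⌋, by linarith⟩
      rw [this]
      split_ifs at hε2 with h'
      · exact ⟨fun _ => by linarith [hε.1], fun _ => ⟨h, h'⟩⟩
      · exact ⟨fun h3 => absurd h3.2 h', fun h3 => by linarith⟩
  obtain ⟨ε, hε⟩ := ((s.eventually_all).mpr key).exists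
  exact ⟨x - ε, hε⟩

/-- A pattern has a frequency in Sturmian words, with bounded discrepancy, uniformly in the word:
its cylinder set is a combination of arcs with endpoints on one orbit. -/
lemma exists_hasDiscrepancy_of_isSturmian {φ : ℝ} (h0 : 0 < φ) (h1 : φ < 1) (p : Pattern) :
    ∃ μ C : ℝ, ∀ X, IsSturmian φ X → HasDiscrepancy (p.occ X) μ C := by
  let L : ℕ → ℝ → ℝ := fun j t => if Int.fract (t + j * φ) < φ then (1 : ℝ) else 0
  have hf : (∏ j ∈ p.ones, (1 - L j)) * ∏ j ∈ p.zeros, L j ∈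
      Algebra.adjoin ℝ (rotArcs φ : Set (ℝ → ℝ)) :=
    Subalgebra.mul_mem _
      (Subalgebra.prod_mem _ fun j _ =>
        Subalgebra.sub_mem _ (Subalgebra.one_mem _) (letter_mem_adjoin h0 h1 j))
      (Subalgebra.prod_mem _ fun j _ => letter_mem_adjoin h0 h1 j)
  obtain ⟨μ, C, hC⟩ := boundedDiscrepancy_of_mem_adjoin hf
  refine ⟨μ, C, fun X hX a n => ?_⟩
  obtain ⟨x, hx⟩ := hX.exists_Ico h1 (Finset.Icc a (a + n + p.width))
  refine le_trans (le_of_eq (congrArg _ ?_)) (hC (x + a * φ) n)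
  congr 1
  refine Finset.sum_congr rfl fun i hi => ?_
  have hX' : ∀ j : ℕ, j ∈ p.ones ∪ p.zeros →
      (X (a + (i : ℤ) + (j : ℤ)) = 0 ↔ Int.fract (x + a * φ + i * φ + j * φ) < φ) := by
    intro j hj
    have hj' := Pattern.le_width hj
    have hi' := Finset.mem_range.mp hi
    rw [hx _ (Finset.mem_Icc.mpr ⟨by omega, by omega⟩)]
    have : x + ((a + (i : ℤ) + (j : ℤ) : ℤ) : ℝ) * φ = x + a * φ + i * φ + j * φ := by
      push_cast
      ring
    rw [this]
  have e1 : ∏ j ∈ p.ones, (1 - L j) (x + a * φ + i * φ) =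
      ∏ j ∈ p.ones, if X (a + (i : ℤ) + (j : ℤ)) = 1 then 1 else 0 := by
    refine Finset.prod_congr rfl fun j hj => ?_
    simp only [L, Pi.sub_apply, Pi.one_apply, eq_one_iff_ne_zero, Ne,
      hX' j (Finset.mem_union_left _ hj)]
    split_ifs <;> simp_all
  have e0 : ∏ j ∈ p.zeros, L j (x + a * φ + i * φ) =
      ∏ j ∈ p.zeros, if X (a + (i : ℤ) + (j : ℤ)) = 0 then 1 else 0 := by
    refine Finset.prod_congr rfl fun j hj => ?_
    simp only [L, hX' j (Finset.mem_union_right _ hj)]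
  rw [Pi.mul_apply, Finset.prod_apply, Finset.prod_apply, e1, e0, Finset.prod_ite_zero,
    Finset.prod_ite_zero]
  unfold Pattern.occ Pattern.OccursAt
  simp only [Finset.prod_const_one]
  split_ifs <;> simp_all

/-! ### Sturmian words have zero energy -/

lemma IsSturmian.exists_abs_sub_lt {φ : ℝ} (hφ : φ < 1) {Z : Config} (hZ : IsSturmian φ Z) {u v : ℤ}
    (hu : Z u = 1) (hv : Z v = 1) : ∃ p : ℤ, |((v : ℝ) - u) * φ - p| < 1 - φ := by
  rw [eq_one_iff_ne_zero] at hu hv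
  obtain ⟨x, hx | hx⟩ := hZ
  · have key : ∀ n : ℤ, Z n ≠ 0 → ∃ z : ℤ, φ ≤ x + n * φ - z ∧ x + n * φ - z < 1 := by
      intro n hn
      refine ⟨⌊x + n * φ⌋, ?_, Int.fract_lt_one _⟩
      by_contra hlt
      exact hn ((hx n).mpr ⟨Int.fract_nonneg _, not_le.mp hlt⟩)
    obtain ⟨y, hy1, hy2⟩ := key u hu
    obtain ⟨z, hz1, hz2⟩ := key v hv
    refine ⟨z - y, ?_⟩
    push_cast
    rw [abs_lt]
    constructor <;> linarith
  · have key : ∀ n : ℤ, Z n ≠ 0 → ∃ z : ℤ, φ < x + n * φ - z ∧ x + n * φ - z ≤ 1 := by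
      intro n hn
      have h1 : x + n * φ - ⌊x + n * φ⌋ < 1 := Int.fract_lt_one _
      rcases (Int.fract_nonneg (x + n * φ)).eq_or_lt with h | h
      · have h2 : Int.fract (x + (n : ℝ) * φ) = x + n * φ - ⌊x + n * φ⌋ := rfl
        refine ⟨⌊x + n * φ⌋ - 1, ?_, ?_⟩ <;> push_cast <;> linarith
      · refine ⟨⌊x + n * φ⌋, ?_, h1.le⟩
        by_contra hlt
        exact hn ((hx n).mpr ⟨h, not_lt.mp hlt⟩)
    obtain ⟨y, hy1, hy2⟩ := key u hu
    obtain ⟨z, hz1, hz2⟩ := key v hv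
    refine ⟨z - y, ?_⟩
    push_cast
    rw [abs_lt]
    constructor <;> linarith

lemma notMem_forbiddenDistances {φ : ℝ} {n : ℕ} {p : ℤ} (h : |(n : ℝ) * φ - p| < 1 - φ) :
    n ∉ forbiddenDistances φ := by
  intro hn
  obtain ⟨h1, h2⟩ := hn
  rw [abs_lt] at h
  have e : Int.fract ((n : ℝ) * φ) = n * φ - ⌊(n : ℝ) * φ⌋ := rfl
  rw [e] at h1 h2
  have h3 : ((⌊(n : ℝ) * φ⌋ : ℤ) : ℝ) < p := by linarith [h.2]
  have h4 : (p : ℝ) < ((⌊(n : ℝ) * φ⌋ + 1 : ℤ) : ℝ) := by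
    push_cast
    linarith [h.1]
  rw [Int.cast_lt] at h3 h4
  omega

lemma sturmianHamiltonian_nonneg (φ α : ℝ) (m : ℕ) (p : Pattern) :
    0 ≤ sturmianHamiltonian φ α m p := by
  unfold sturmianHamiltonian
  split_ifs
  · norm_num
  · positivity
  · exact le_rfl

lemma sturmianHamiltonian_eq_zero {φ : ℝ} (hφ : φ < 1) (α : ℝ) {m : ℕ} (hm : ForbiddenZeros φ m)
    {X : Config} (hX : IsSturmian φ X) {p : Pattern} {i : ℤ} (hp : p.OccursAt X i) :
    sturmianHamiltonian φ α m p = 0 := by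
  unfold sturmianHamiltonian
  rw [if_neg, if_neg]
  · rintro ⟨-, n, hn, h⟩
    have h0 := hp.1 0 (by simp [h])
    have h1 := hp.1 n (by simp [h])
    obtain ⟨q, hq⟩ := hX.exists_abs_sub_lt hφ h0 h1
    refine notMem_forbiddenDistances (p := q) ?_ hn
    convert hq using 3
    push_cast
    ring
  · rintro ⟨-, h⟩
    exact hm X hX ⟨i, fun j hj => hp.2 j (by rw [h]; exact Finset.mem_range.mpr hj)⟩

lemma energy_sturmian {φ : ℝ} (hφ : φ < 1) (α : ℝ) {m : ℕ} (hm : ForbiddenZeros φ m)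
    {X : Config} (hX : IsSturmian φ X) (a b : ℤ) :
    energy (sturmianHamiltonian φ α m) X a b = 0 :=
  Finset.sum_eq_zero fun _ _ => Finset.sum_eq_zero fun _ hS =>
    sturmianHamiltonian_eq_zero hφ α hm hX
      ((patternAt_eq_iff (zero_notMem_of_mem_powerset hS)).mp rfl).2

lemma energy_nonneg {H : Hamiltonian} (h : ∀ p, 0 ≤ H p) (X : Config) (a b : ℤ) :
    0 ≤ energy H X a b :=
  Finset.sum_nonneg fun _ _ => Finset.sum_nonneg fun _ _ => h _

/-! ### The energy of a periodically Sturmian word -/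

/-- The pattern of two symbols `1` at distance `n`. -/
def pairPattern (n : ℕ) : Pattern where
  ones := {0, n}
  zeros := ∅
  disjoint := Finset.disjoint_empty_right _
  leftmost := by simp

/-- The word of `m` consecutive symbols `0`. -/
def zerosPattern (m : ℕ) (hm : 0 < m) : Pattern where
  ones := ∅
  zeros := Finset.range m
  disjoint := Finset.disjoint_empty_left _
  leftmost := by simpa using hm

lemma sturmianHamiltonian_pairPattern {φ : ℝ} (α : ℝ) (m : ℕ) {n : ℕ}
    (hn : n ∈ forbiddenDistances φ) :
    sturmianHamiltonian φ α m (pairPattern n) = 1 / (n : ℝ) ^ α := by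
  unfold sturmianHamiltonian
  rw [if_neg, if_pos]
  · simp [pairPattern]
  · exact ⟨rfl, n, hn, rfl⟩
  · simp [pairPattern]

lemma sturmianHamiltonian_zerosPattern (φ α : ℝ) {m : ℕ} (hm : 0 < m) :
    sturmianHamiltonian φ α m (zerosPattern m hm) = 1 :=
  if_pos ⟨rfl, rfl⟩

lemma pairPattern_occ {Y : Config} {i : ℤ} {n : ℕ} (h0 : Y i = 1) (hn : Y (i + (n : ℤ)) = 1) :
    (pairPattern n).occ Y i = 1 := by
  refine if_pos ⟨?_, by simp [pairPattern]⟩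
  simp [pairPattern, h0, hn]

lemma zerosPattern_occ {Y : Config} {i : ℤ} {m : ℕ} (hm : 0 < m)
    (h : ∀ j : ℕ, j < m → Y (i + (j : ℤ)) = 0) : (zerosPattern m hm).occ Y i = 1 := by
  refine if_pos ⟨by simp [zerosPattern], fun j hj => h j (Finset.mem_range.mp hj)⟩

lemma pairPattern_injective : Function.Injective pairPattern := by
  intro n n' h
  have h1 : (pairPattern n).ones.sup id = (pairPattern n').ones.sup id := by rw [h]
  simpa [pairPattern] using h1

/-- In a periodic word without `m` consecutive `0`s the symbols `1` have density at least
`1 / m`. -/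
lemma le_mul_card_ones {Y : Config} {k m : ℕ} (hY : ∀ i : ℤ, Y (i + (k : ℤ)) = Y i)
    (h : ∀ i : ℤ, ∃ j : ℕ, j < m ∧ Y (i + (j : ℤ)) = 1) (a : ℤ) :
    k ≤ m * ((Finset.range k).filter fun r : ℕ => Y (a + (r : ℤ)) = 1).card := by
  set g : ℤ → ℝ := fun i => if Y i = 1 then 1 else 0 with hg
  have gp : Function.Periodic g (k : ℤ) := fun i => by simp only [hg, hY i]
  have h1 : (k : ℝ) ≤ ∑ r ∈ Finset.range k, ∑ j ∈ Finset.range m, g (a + (r : ℤ) + (j : ℤ)) := by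
    have : (k : ℝ) = ∑ r ∈ Finset.range k, (1 : ℝ) := by simp
    rw [this]
    refine Finset.sum_le_sum fun r _ => ?_
    obtain ⟨j, hj, hj1⟩ := h (a + (r : ℤ))
    have : (1 : ℝ) = g (a + (r : ℤ) + (j : ℤ)) := by simp [hg, hj1]
    rw [this]
    exact Finset.single_le_sum (f := fun j : ℕ => g (a + (r : ℤ) + (j : ℤ)))
      (fun j _ => by simp only [hg]; split_ifs <;> norm_num) (Finset.mem_range.mpr hj)
  rw [Finset.sum_comm] at h1
  have h2 : ∀ j ∈ Finset.range m, ∑ r ∈ Finset.range k, g (a + (r : ℤ) + (j : ℤ)) =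
      ((Finset.range k).filter fun r : ℕ => Y (a + (r : ℤ)) = 1).card := by
    intro j _
    have := sum_range_periodic gp (a + (j : ℤ)) a
    simp only [add_right_comm a _ (j : ℤ)]
    rw [this]
    simp [hg]
  rw [Finset.sum_congr rfl h2] at h1
  simp only [Finset.sum_const, Finset.card_range, nsmul_eq_mul] at h1
  exact_mod_cast h1

/-- If `N φ` is at distance at least `2 (1 - φ)` from the integers, then each distance `n` that
differs from `N` by the distance of two symbols `1` of a Sturmian word is forbidden. -/
lemma mem_forbiddenDistances {φ : ℝ} {n : ℕ} {x θ s : ℝ} {z : ℤ}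
    (hn : (n : ℝ) * φ = z + s + θ) (hs : s = x ∨ s = -x) (hx1 : 2 - 2 * φ ≤ x)
    (hx2 : x ≤ 2 * φ - 1) (hθ : |θ| < 1 - φ) : n ∈ forbiddenDistances φ := by
  rw [abs_lt] at hθ
  have hφ : φ < 1 := by linarith [hθ.1, hθ.2]
  change Int.fract ((n : ℝ) * φ) ∈ Set.Icc (1 - φ) φ
  rcases hs with rfl | rfl
  · have : Int.fract ((n : ℝ) * φ) = s + θ := by
      rw [Int.fract_eq_iff]
      exact ⟨by linarith, by linarith, z, by linarith⟩
    rw [this]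
    constructor <;> linarith
  · have : Int.fract ((n : ℝ) * φ) = 1 - x + θ := by
      rw [Int.fract_eq_iff]
      exact ⟨by linarith, by linarith, z - 1, by push_cast; linarith⟩
    rw [this]
    constructor <;> linarith

/-- A multiple `q k φ` that is close to an integer, but not too close: the upper bound is
Dirichlet's, the lower one is bad approximability. -/
lemma exists_mul_near_int {φ c : ℝ}
    (hc : ∀ (p : ℤ) (q : ℕ), 0 < q → c / (q : ℝ) ^ 2 < |φ - (p : ℝ) / (q : ℝ)|)
    (hc0 : 0 < c) {Q k : ℕ} (hQ : 0 < Q) (hk : 0 < k) :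
    ∃ (q : ℕ) (p : ℤ), 0 < q ∧ q ≤ Q ∧ c / (Q * k) ≤ |(q : ℝ) * k * φ - p| ∧
      |(q : ℝ) * k * φ - p| ≤ 1 / (Q + 1) := by
  obtain ⟨p, q, hq0, hqQ, h⟩ := Real.exists_int_int_abs_mul_sub_le ((k : ℝ) * φ) hQ
  lift q to ℕ using hq0.le
  have hq0 : 0 < q := by exact_mod_cast hq0
  have hqQ : q ≤ Q := by exact_mod_cast hqQ
  have e : ((q : ℤ) : ℝ) * ((k : ℝ) * φ) = q * k * φ := by
    push_cast
    ring
  rw [e] at h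
  refine ⟨q, p, hq0, hqQ, ?_, h⟩
  have h1 := hc p (q * k) (Nat.mul_pos hq0 hk)
  have hq' : (0 : ℝ) < q := by exact_mod_cast hq0
  have hk' : (0 : ℝ) < k := by exact_mod_cast hk
  have hqQ' : (q : ℝ) ≤ Q := by exact_mod_cast hqQ
  have hqk : (0 : ℝ) < q * k := by positivity
  have e2 : (q : ℝ) * k * φ - p = (q * k) * (φ - p / ((q * k : ℕ) : ℝ)) := by
    push_cast
    field_simp
  rw [e2, abs_mul, abs_of_pos hqk]
  calc c / (Q * k) ≤ c / (q * k) :=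
        div_le_div_of_nonneg_left hc0.le hqk (mul_le_mul_of_nonneg_right hqQ' hk'.le)
    _ = (q * k) * (c / ((q * k : ℕ) : ℝ) ^ 2) := by
        push_cast
        field_simp
    _ ≤ _ := mul_le_mul_of_nonneg_left h1.le hqk.le

lemma half_div_le_card_Icc {u v d : ℝ} (hu : 0 ≤ u) (hd : 0 < d) (h : d ≤ (v - u) / 2) :
    (v - u) / (2 * d) ≤ (Finset.Icc ⌈u / d⌉₊ ⌊v / d⌋₊).card := by
  rw [Nat.card_Icc]
  have h1 := Nat.ceil_lt_add_one (div_nonneg hu hd.le)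
  have h2 := Nat.lt_floor_add_one (v / d)
  have h3 : ((⌊v / d⌋₊ + 1 : ℕ) : ℝ) - (⌈u / d⌉₊ : ℝ) ≤ ((⌊v / d⌋₊ + 1 - ⌈u / d⌉₊ : ℕ) : ℝ) := by
    rw [sub_le_iff_le_add]
    exact_mod_cast (show _ ≤ ⌊v / d⌋₊ + 1 - ⌈u / d⌉₊ + ⌈u / d⌉₊ by omega)
  have h4 : (v - u) / (2 * d) + 1 ≤ (v - u) / d := by
    have : (v - u) / d = (v - u) / (2 * d) + (v - u) / 2 / d := by
      field_simp
      ring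
    rw [this]
    have : 1 ≤ (v - u) / 2 / d := by rwa [le_div_iff₀ hd, one_mul]
    linarith
  rw [sub_div v u d] at h4
  push_cast at h3
  linarith

/-- The pair energy per period of a periodically Sturmian word without `m` consecutive `0`s,
counted up to the distance `2 Q k / d`, where `d` is the distance of `q k φ` from the integers.
Each of the about `1 / d` multiples `i q k` with `i q k φ` near `1 / 2` modulo `1`
contributes all pairs of `1`s that are that many periods apart. -/
lemma card_mul_le_sum_pairPattern {φ α : ℝ} (hφ : φ ∈ Set.Ioo (3 / 4 : ℝ) 1) (hα : α ≤ 3 / 2)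
    {k q Q : ℕ} (hk : 0 < k) (hq : 0 < q) (hqQ : q ≤ Q) {p : ℤ} {d : ℝ}
    (hd : |(q : ℝ) * k * φ - p| = d) (hd0 : 0 < d)
    {Y Z : Config} (hY : ∀ i : ℤ, Y (i + (k : ℤ)) = Y i) (hZ : IsSturmian φ Z) {a b : ℤ}
    (hYZ : ∀ j : ℕ, j < k → Y (a + (j : ℤ)) = Z (b + (j : ℤ))) :
    ∃ F : Finset ℕ, (∀ n ∈ F, n ∈ forbiddenDistances φ) ∧
      ((Finset.Icc ⌈(2 - 2 * φ) / d⌉₊ ⌊(2 * φ - 1) / d⌋₊).card : ℝ) *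
        (((Finset.range k).filter fun r : ℕ => Y (a + (r : ℤ)) = 1).card : ℝ) ^ 2 /
          (2 * Q * k / d) ^ (3 / 2 : ℝ) ≤
      ∑ n ∈ F, 1 / (n : ℝ) ^ α * ∑ r ∈ Finset.range k, (pairPattern n).occ Y (a + (r : ℤ)) := by
  classical
  obtain ⟨hφ1, hφ2⟩ := hφ
  set J := Finset.Icc ⌈(2 - 2 * φ) / d⌉₊ ⌊(2 * φ - 1) / d⌋₊ with hJ
  set R := (Finset.range k).filter fun r : ℕ => Y (a + (r : ℤ)) = 1 with hR
  set T := 2 * Q * k / d with hT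
  -- the pair of sites `a + r` and `a + r' + i q k`
  let dist : ℕ × ℕ × ℕ → ℕ := fun t => t.1 * q * k + t.2.2 - t.2.1
  let F := (J ×ˢ R ×ˢ R).image dist
  have hJpos : ∀ i ∈ J, 0 < i := by
    intro i hi
    have h1 : 0 < ⌈(2 - 2 * φ) / d⌉₊ := Nat.ceil_pos.mpr (div_pos (by linarith) hd0)
    exact h1.trans_le (Finset.mem_Icc.mp hi).1
  have hmem : ∀ t ∈ J ×ˢ R ×ˢ R, t.1 ∈ J ∧ (t.2.1 < k ∧ Y (a + (t.2.1 : ℤ)) = 1) ∧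
      (t.2.2 < k ∧ Y (a + (t.2.2 : ℤ)) = 1) := by
    intro t ht
    simpa [hR, Finset.mem_product] using ht
  have hdist : ∀ t ∈ J ×ˢ R ×ˢ R, dist t + t.2.1 = t.1 * q * k + t.2.2 ∧ 0 < dist t := by
    intro t ht
    obtain ⟨h1, ⟨h2, -⟩, h3, -⟩ := hmem t ht
    have h4 : 1 * k ≤ t.1 * q * k :=
      Nat.mul_le_mul_right _ (Nat.mul_pos (hJpos _ h1) hq)
    simp only [dist]
    omega
  have hYk : ∀ (i : ℤ) (l : ℕ), Y (i + (l : ℤ) * (k : ℤ)) = Y i := by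
    intro i l
    have hp : Function.Periodic Y (k : ℤ) := hY
    exact (hp.nat_mul l) i
  have hJle : ∀ i ∈ J, (2 - 2 * φ) ≤ i * d ∧ i * d ≤ 2 * φ - 1 := by
    intro i hi
    obtain ⟨h1, h2⟩ := Finset.mem_Icc.mp hi
    have h1' := Nat.ceil_le.mp h1
    have h2' := (Nat.le_floor_iff' (hJpos i hi).ne').mp h2
    exact ⟨(div_le_iff₀ hd0).mp h1', (le_div_iff₀ hd0).mp h2'⟩
  have hforb : ∀ n ∈ F, n ∈ forbiddenDistances φ := by
    intro n hn
    obtain ⟨t, ht, rfl⟩ := Finset.mem_image.mp hn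
    obtain ⟨h1, ⟨h2, h2'⟩, h3, h3'⟩ := hmem t ht
    rw [hYZ _ h2] at h2'
    rw [hYZ _ h3] at h3'
    obtain ⟨z, hz⟩ := hZ.exists_abs_sub_lt hφ2 h2' h3'
    have e : (dist t : ℝ) = t.1 * q * k + t.2.2 - t.2.1 := by
      rw [eq_sub_iff_add_eq]
      exact_mod_cast (hdist t ht).1
    refine mem_forbiddenDistances (x := t.1 * d) (s := t.1 * ((q : ℝ) * k * φ - p))
      (z := t.1 * p + z) (θ := ((t.2.2 : ℝ) - t.2.1) * φ - z) ?_ ?_ (hJle _ h1).1 (hJle _ h1).2 ?_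
    · rw [e]
      push_cast
      ring
    · rcases abs_choice ((q : ℝ) * k * φ - p) with h | h
      · left
        rw [← hd, h]
      · right
        rw [← hd, h]
        ring
    · convert hz using 3
      push_cast
      ring
  have hTpos : 0 ≤ T := by positivity
  have hle : ∀ n ∈ F, 1 / T ^ (3 / 2 : ℝ) ≤ 1 / (n : ℝ) ^ α := by
    intro n hn
    obtain ⟨t, ht, rfl⟩ := Finset.mem_image.mp hn
    obtain ⟨h1, ⟨h2, -⟩, h3, -⟩ := hmem t ht
    obtain ⟨h4, h5⟩ := hdist t ht
    have h6 : 1 ≤ (dist t : ℝ) := by exact_mod_cast h5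
    have h7 : (dist t : ℝ) ≤ T := by
      have h8 : 1 * k ≤ t.1 * q * k :=
        Nat.mul_le_mul_right _ (Nat.mul_pos (hJpos _ h1) hq)
      have h9 : dist t ≤ 2 * (t.1 * q * k) := by omega
      have h10 : (t.1 : ℝ) ≤ 1 / d := by
        rw [le_div_iff₀ hd0]
        linarith [(hJle _ h1).2]
      calc (dist t : ℝ) ≤ 2 * (t.1 * q * k) := by exact_mod_cast h9
        _ ≤ 2 * (1 / d * Q * k) := by
          have : (q : ℝ) ≤ Q := by exact_mod_cast hqQ
          gcongr
        _ = T := by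
          rw [hT]
          ring
    refine one_div_le_one_div_of_le (Real.rpow_pos_of_pos (by linarith) _) ?_
    exact (Real.rpow_le_rpow_of_exponent_le h6 hα).trans
      (Real.rpow_le_rpow (by linarith) h7 (by norm_num))
  refine ⟨F, hforb, ?_⟩
  -- the triples are counted by pairs of a distance and a site
  let G := (F ×ˢ Finset.range k).filter fun s : ℕ × ℕ =>
    (pairPattern s.1).occ Y (a + (s.2 : ℤ)) = 1
  have hcard : (J ×ˢ R ×ˢ R).card ≤ G.card := by
    refine Finset.card_le_card_of_injOn (fun t => (dist t, t.2.1)) ?_ ?_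
    · intro t ht
      have ht' : t ∈ J ×ˢ R ×ˢ R := ht
      obtain ⟨h1, ⟨h2, h2'⟩, h3, h3'⟩ := hmem t ht'
      refine Finset.mem_coe.mpr (Finset.mem_filter.mpr ⟨Finset.mem_product.mpr
        ⟨Finset.mem_image_of_mem _ ht', Finset.mem_range.mpr h2⟩, pairPattern_occ h2' ?_⟩)
      have e : a + (t.2.1 : ℤ) + (dist t : ℤ) =
          a + (t.2.2 : ℤ) + ((t.1 * q : ℕ) : ℤ) * (k : ℤ) := by
        have : ((dist t + t.2.1 : ℕ) : ℤ) = ((t.1 * q * k + t.2.2 : ℕ) : ℤ) :=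
          congrArg _ (hdist t ht').1
        push_cast at this ⊢
        linarith
      change Y (a + (t.2.1 : ℤ) + (dist t : ℤ)) = 1
      rw [e, hYk, h3']
    · intro t ht t' ht' h
      obtain ⟨h1, ⟨h2, -⟩, h3, -⟩ := hmem t ht
      obtain ⟨h1', ⟨h2', -⟩, h3', -⟩ := hmem t' ht'
      obtain ⟨h4, h5⟩ := Prod.mk.inj h
      have h6 := (hdist t ht).1
      have h6' := (hdist t' ht').1
      have h7 : t.1 * q * k + t.2.2 = t'.1 * q * k + t'.2.2 := by
        rw [← h6, ← h6', h4, h5]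
      have h8 : t.2.2 = t'.2.2 := by
        have := congrArg (· % k) h7
        simpa [Nat.mod_eq_of_lt h3, Nat.mod_eq_of_lt h3'] using this
      have h9 : t.1 = t'.1 := by
        rw [h8, Nat.add_right_cancel_iff] at h7
        exact Nat.eq_of_mul_eq_mul_right hq (Nat.eq_of_mul_eq_mul_right hk h7)
      exact Prod.ext h9 (Prod.ext h5 h8)
  have hcard' : (J.card : ℝ) * (R.card : ℝ) ^ 2 ≤ G.card := by
    rw [Finset.card_product, Finset.card_product] at hcard
    calc (J.card : ℝ) * (R.card : ℝ) ^ 2 = ((J.card * (R.card * R.card) : ℕ) : ℝ) := by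
          push_cast
          ring
      _ ≤ G.card := by exact_mod_cast hcard
  have hT' : 0 ≤ T ^ (3 / 2 : ℝ) := Real.rpow_nonneg hTpos _
  calc (J.card : ℝ) * (R.card : ℝ) ^ 2 / T ^ (3 / 2 : ℝ)
      ≤ G.card / T ^ (3 / 2 : ℝ) := div_le_div_of_nonneg_right hcard' hT'
    _ = ∑ s ∈ G, 1 / T ^ (3 / 2 : ℝ) * (pairPattern s.1).occ Y (a + (s.2 : ℤ)) := by
        rw [Finset.sum_congr rfl (g := fun _ => 1 / T ^ (3 / 2 : ℝ))
          fun s hs => by rw [(Finset.mem_filter.mp hs).2, mul_one]]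
        simp [div_eq_mul_inv]
    _ ≤ ∑ s ∈ G, 1 / (s.1 : ℝ) ^ α * (pairPattern s.1).occ Y (a + (s.2 : ℤ)) := by
        refine Finset.sum_le_sum fun s hs => ?_
        exact mul_le_mul_of_nonneg_right
          (hle _ (Finset.mem_product.mp (Finset.mem_filter.mp hs).1).1) (Pattern.occ_nonneg _ _ _)
    _ ≤ ∑ s ∈ F ×ˢ Finset.range k,
          1 / (s.1 : ℝ) ^ α * (pairPattern s.1).occ Y (a + (s.2 : ℤ)) := by
        refine Finset.sum_le_sum_of_subset_of_nonneg (Finset.filter_subset _ _) fun s _ _ => ?_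
        have := Pattern.occ_nonneg (pairPattern s.1) Y (a + (s.2 : ℤ))
        positivity
    _ = _ := by
        rw [Finset.sum_product]
        simp only [Finset.mul_sum]

/-- The pair energy per period is bounded below uniformly in the period; this is where the
exponent `3 / 2` enters. -/
lemma exists_le_sum_pairPattern {φ : ℝ} (hφ : φ ∈ Set.Ioo (3 / 4 : ℝ) 1)
    (hbad : BadlyApproximable φ) {m : ℕ} (hm : 0 < m) :
    ∃ E : ℝ, 0 < E ∧ ∀ (α : ℝ), α ≤ 3 / 2 → ∀ (k : ℕ), 0 < k → ∀ Y Z : Config,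
      (∀ i : ℤ, Y (i + (k : ℤ)) = Y i) → IsSturmian φ Z → ∀ a b : ℤ,
      (∀ j : ℕ, j < k → Y (a + (j : ℤ)) = Z (b + (j : ℤ))) →
      (∀ i : ℤ, ∃ j : ℕ, j < m ∧ Y (i + (j : ℤ)) = 1) →
      ∃ F : Finset ℕ, (∀ n ∈ F, n ∈ forbiddenDistances φ) ∧
        E ≤ ∑ n ∈ F, 1 / (n : ℝ) ^ α *
          ∑ r ∈ Finset.range k, (pairPattern n).occ Y (a + (r : ℤ)) := by
  obtain ⟨c, hc0, hc⟩ := hbad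
  have hφ1 := hφ.1
  set L := 4 * φ - 3 with hL
  have hL0 : 0 < L := by linarith
  obtain ⟨Q, hQ⟩ := exists_nat_gt (2 / L)
  have hQ0 : (0 : ℝ) < Q := (div_pos two_pos hL0).trans hQ
  have hQ0' : 0 < Q := by exact_mod_cast hQ0
  set S := Real.sqrt (2 * Q ^ 2 / c) with hS
  have hS0 : 0 < S := Real.sqrt_pos.mpr (by positivity)
  have hm' : (0 : ℝ) < m := by exact_mod_cast hm
  refine ⟨L / (4 * Q * m ^ 2 * S), by positivity, ?_⟩
  intro α hα k hk Y Z hY hZ a b hYZ hone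
  have hk' : (0 : ℝ) < k := by exact_mod_cast hk
  obtain ⟨q, p, hq, hqQ, hd1, hd2⟩ := exists_mul_near_int hc hc0 hQ0' hk
  set d := |(q : ℝ) * k * φ - p| with hd
  have hd0 : 0 < d := (by positivity : 0 < c / (Q * k)).trans_le hd1
  obtain ⟨F, hF, hsum⟩ := card_mul_le_sum_pairPattern hφ hα hk hq hqQ hd.symm hd0 hY hZ hYZ
  refine ⟨F, hF, le_trans ?_ hsum⟩
  have hdL : d ≤ L / 2 := by
    refine hd2.trans ?_
    rw [div_le_div_iff₀ (by positivity) two_pos]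
    rw [div_lt_iff₀ hL0] at hQ
    linarith
  have hJ := half_div_le_card_Icc (u := 2 - 2 * φ) (v := 2 * φ - 1) (by linarith [hφ.2]) hd0
    (by linarith)
  have eL : 2 * φ - 1 - (2 - 2 * φ) = L := by rw [hL]; ring
  rw [eL] at hJ
  have hN : (k : ℝ) / m ≤ ((Finset.range k).filter fun r : ℕ => Y (a + (r : ℤ)) = 1).card := by
    rw [div_le_iff₀ hm', mul_comm]
    exact_mod_cast le_mul_card_ones hY hone a
  set T := 2 * Q * k / d with hT
  have hT0 : 0 < T := by positivity
  have hTS : Real.sqrt T ≤ k * S := by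
    have h1 : T ≤ k ^ 2 * (2 * Q ^ 2 / c) := by
      rw [hT, div_le_iff₀ hd0]
      rw [div_le_iff₀ (by positivity)] at hd1
      calc 2 * Q * k = 2 * Q * k / c * c := by field_simp
        _ ≤ 2 * Q * k / c * (d * (Q * k)) := by gcongr
        _ = _ := by ring
    rw [hS]
    calc Real.sqrt T ≤ Real.sqrt (k ^ 2 * (2 * Q ^ 2 / c)) := Real.sqrt_le_sqrt h1
      _ = k * Real.sqrt (2 * Q ^ 2 / c) := by
        rw [Real.sqrt_mul (by positivity), Real.sqrt_sq hk'.le]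
  have hTp : T ^ (3 / 2 : ℝ) = T * Real.sqrt T := by
    rw [Real.sqrt_eq_rpow, show (3 / 2 : ℝ) = 1 + 1 / 2 by norm_num, Real.rpow_add hT0,
      Real.rpow_one]
  rw [hTp]
  have hsT : 0 < Real.sqrt T := Real.sqrt_pos.mpr hT0
  calc L / (4 * Q * m ^ 2 * S) = L / (2 * d) * (k / m) ^ 2 / (T * (k * S)) := by
        rw [hT]
        field_simp
        ring
    _ ≤ _ := by gcongr

/-! ### Comparison of energy densities -/

lemma exists_isSturmian {φ : ℝ} (x : ℝ) : ∃ X, IsSturmian φ X := by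
  classical
  refine ⟨fun n => if Int.fract (x + (n : ℝ) * φ) ∈ Set.Ico 0 φ then 0 else 1, x, Or.inl ?_⟩
  intro n
  by_cases h : Int.fract (x + (n : ℝ) * φ) ∈ Set.Ico 0 φ
  · simp only [h, if_true]
  · simp only [h, if_false, iff_false]
    decide

lemma ForbiddenZeros.pos {φ : ℝ} {m : ℕ} (hm : ForbiddenZeros φ m) : 0 < m := by
  rcases Nat.eq_zero_or_pos m with rfl | h
  · obtain ⟨X, hX⟩ := exists_isSturmian (φ := φ) 0
    exact absurd ⟨0, fun j hj => absurd hj (Nat.not_lt_zero j)⟩ (hm X hX)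
  · exact h

/-- The energy per period of a periodically Sturmian word is bounded below uniformly in the
word, already when finitely many patterns are taken into account. -/
lemma exists_le_period_energy {φ : ℝ} (hφ : φ ∈ Set.Ioo (3 / 4 : ℝ) 1)
    (hbad : BadlyApproximable φ) {α : ℝ} (hα : α ≤ 3 / 2) {m : ℕ} (hm : 0 < m) :
    ∃ E : ℝ, 0 < E ∧ ∀ (k : ℕ), 0 < k → ∀ Y Z : Config,
      (∀ i : ℤ, Y (i + (k : ℤ)) = Y i) → IsSturmian φ Z → ∀ a b : ℤ,
      (∀ j : ℕ, j < k → Y (a + (j : ℤ)) = Z (b + (j : ℤ))) →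
      ∃ Q : Finset Pattern, E ≤ ∑ p ∈ Q, sturmianHamiltonian φ α m p *
          ∑ r ∈ Finset.range k, p.occ Y (a + (r : ℤ)) := by
  classical
  obtain ⟨E, hE0, hE⟩ := exists_le_sum_pairPattern hφ hbad hm
  refine ⟨min 1 E, lt_min one_pos hE0, fun k hk Y Z hY hZ a b hYZ => ?_⟩
  by_cases hone : ∀ i : ℤ, ∃ j : ℕ, j < m ∧ Y (i + (j : ℤ)) = 1
  · obtain ⟨F, hF, hsum⟩ := hE α hα k hk Y Z hY hZ a b hYZ hone
    refine ⟨F.image pairPattern, (min_le_right _ _).trans (hsum.trans (le_of_eq ?_))⟩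
    rw [Finset.sum_image pairPattern_injective.injOn]
    exact Finset.sum_congr rfl fun n hn => by rw [sturmianHamiltonian_pairPattern α m (hF n hn)]
  · push Not at hone
    obtain ⟨i, hi⟩ := hone
    refine ⟨{zerosPattern m hm}, (min_le_left _ _).trans ?_⟩
    rw [Finset.sum_singleton, sturmianHamiltonian_zerosPattern, one_mul]
    have hper : Function.Periodic ((zerosPattern m hm).occ Y) (k : ℤ) := fun i =>
      Pattern.occ_congr fun j _ => by rw [add_right_comm, hY]
    rw [sum_range_periodic hper a i]
    have h1 : (zerosPattern m hm).occ Y (i + ((0 : ℕ) : ℤ)) = 1 := by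
      rw [Nat.cast_zero, add_zero]
      refine zerosPattern_occ hm fun j hj => ?_
      by_contra h
      exact hi j hj ((eq_one_iff_ne_zero _).mpr h)
    rw [← h1]
    exact Finset.single_le_sum (f := fun r : ℕ => (zerosPattern m hm).occ Y (i + (r : ℤ)))
      (fun _ _ => Pattern.occ_nonneg _ _ _) (Finset.mem_range.mpr hk)

/-- Closing up a finite word periodically changes the number of occurrences of a pattern by at
most the width of the pattern. -/
lemma abs_sum_occ_sub_le (p : Pattern) {Y Z : Config} {k : ℕ} {a b : ℤ}
    (hYZ : ∀ j : ℕ, j < k → Y (a + (j : ℤ)) = Z (b + (j : ℤ))) :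
    |∑ j ∈ Finset.range k, p.occ Y (a + (j : ℤ)) - ∑ j ∈ Finset.range k, p.occ Z (b + (j : ℤ))|
      ≤ p.width := by
  rw [← Finset.sum_sub_distrib]
  refine (Finset.abs_sum_le_sum_abs _ _).trans ?_
  have h : ∀ j ∈ Finset.range k, |p.occ Y (a + (j : ℤ)) - p.occ Z (b + (j : ℤ))| ≤
      if k ≤ j + p.width then (1 : ℝ) else 0 := by
    intro j _
    split_ifs with hj
    · have h1 := p.occ_nonneg Y (a + (j : ℤ))
      have h2 := p.occ_le_one Y (a + (j : ℤ))
      have h3 := p.occ_nonneg Z (b + (j : ℤ))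
      have h4 := p.occ_le_one Z (b + (j : ℤ))
      rw [abs_le]
      constructor <;> linarith
    · rw [Pattern.occ_congr (X := Y) (Y := Z) (i' := b + (j : ℤ)), sub_self, abs_zero]
      intro l hl
      have := hYZ (j + l) (by omega)
      push_cast at this
      rw [add_assoc, add_assoc, this]
  refine (Finset.sum_le_sum h).trans ?_
  rw [Finset.sum_boole]
  have : (Finset.range k).filter (fun j => k ≤ j + p.width) ⊆ Finset.Ico (k - p.width) k := by
    intro j hj
    simp only [Finset.mem_filter, Finset.mem_range, Finset.mem_Ico] at *
    omega
  have h2 := Finset.card_le_card this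
  rw [Nat.card_Ico] at h2
  exact_mod_cast h2.trans (by omega)

lemma energyDensity_eq_of_tendsto {H : Hamiltonian} {X : Config} {ρ : ℝ}
    (h : Tendsto (fun K : ℕ => energy H X (-(K : ℤ)) (K : ℤ) / (2 * (K : ℝ) + 1)) atTop (𝓝 ρ)) :
    energyDensity H X = ρ :=
  ((continuous_coe_real_ereal.tendsto ρ).comp h).liminf_eq

lemma energyDensity_mono {H D : Hamiltonian} (h : ∀ p, H p ≤ D p) (X : Config) :
    energyDensity H X ≤ energyDensity D X := by
  refine liminf_le_liminf (Eventually.of_forall fun K => ?_)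
  rw [EReal.coe_le_coe_iff]
  exact div_le_div_of_nonneg_right (energy_mono h X _ _) (by positivity)

end LatticeGas

open Filter Topology LatticeGas in
theorem mainTheorem1 (φ : ℝ) (hφ : φ ∈ Set.Ioo (3 / 4 : ℝ) 1)
    (hbad : LatticeGas.BadlyApproximable φ)
    (α : ℝ) (hα₁ : 1 < α) (hα₂ : α ≤ 3 / 2)
    (m : ℕ) (hm : LatticeGas.ForbiddenZeros φ m)
    (X : LatticeGas.Config) (hX : LatticeGas.IsSturmian φ X) :
    LatticeGas.IsStableGroundState (LatticeGas.sturmianHamiltonian φ α m) X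
      (LatticeGas.periodicallySturmian φ) := by
  classical
  have h0 : 0 < φ := by linarith [hφ.1]
  set H := sturmianHamiltonian φ α m with hH
  refine ⟨fun Y _ ε hε => Eventually.of_forall fun n => ?_, fun P => ?_⟩
  · rw [hH, energy_sturmian hφ.2 α hm hX]
    linarith [energy_nonneg (sturmianHamiltonian_nonneg φ α m) Y (-(n : ℤ)) n]
  obtain ⟨E, hE0, hE⟩ := exists_le_period_energy hφ hbad hα₂ hm.pos
  choose μ C hC using exists_hasDiscrepancy_of_isSturmian h0 hφ.2
  have hC0 : ∀ p, 0 ≤ C p := fun p => (abs_nonneg _).trans (hC p X hX 0 0)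
  set B := ∑ p ∈ P, (C p + p.width) with hB
  have hB0 : 0 ≤ B := Finset.sum_nonneg fun p _ => add_nonneg (hC0 p) (Nat.cast_nonneg _)
  -- A perturbation below `E / (B + 1)` gains at most `E * B / (B + 1)` per period, while a
  -- periodically Sturmian word pays at least `E` per period.
  refine ⟨E / (B + 1), by positivity, ?_⟩
  rintro H' ⟨hHP, hHQ⟩ Y ⟨k, hk, hY, Z, hZ, a, b, hYZ⟩
  have hk' : (0 : ℝ) < k := by exact_mod_cast hk
  set D : Hamiltonian := fun p => H' p - H p with hD
  have hDP : ∀ p, p ∉ P → D p = 0 := fun p hp => by rw [hD]; simp [hHQ p hp]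
  have hX' : energyDensity H' X = ((∑ p ∈ P, D p * μ p : ℝ) : EReal) := by
    refine energyDensity_eq_of_tendsto ?_
    have e : H' = fun p => H p + D p := by
      ext p
      simp [hD]
    have e2 : ∀ K : ℕ, energy H' X (-(K : ℤ)) K = energy D X (-(K : ℤ)) K := by
      intro K
      rw [e, energy_add, hH, energy_sturmian hφ.2 α hm hX, zero_add]
    simp only [e2]
    exact tendsto_energy_div hDP fun p _ => hC p X hX
  -- the density of `Y` is bounded below by the one for a finite-range part of `H'`
  obtain ⟨Q, hQ⟩ := hE k hk Y Z hY hZ a b hYZ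
  set s : Pattern → ℝ := fun p => ∑ j ∈ Finset.range k, p.occ Y (a + (j : ℤ)) with hs
  have hper : ∀ p : Pattern, Function.Periodic (p.occ Y) (k : ℤ) := fun p i =>
    Pattern.occ_congr fun j _ => by rw [add_right_comm, hY]
  choose C' hC' using fun p : Pattern => exists_hasDiscrepancy_of_periodic hk (hper p) a
  set G : Hamiltonian := fun p => if p ∈ Q then H p else 0 with hG
  have hGQ : ∀ p, p ∉ Q → G p = 0 := fun p hp => if_neg hp
  have hY1 : energyDensity (fun p => G p + D p) Y ≤ energyDensity H' Y := by
    refine energyDensity_mono (fun p => ?_) Y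
    have : G p ≤ H p := by
      simp only [hG]
      split_ifs
      · exact le_rfl
      · exact sturmianHamiltonian_nonneg φ α m p
    simp only [hD]
    linarith
  have hY2 : energyDensity (fun p => G p + D p) Y =
      ((∑ p ∈ Q, G p * (s p / k) + ∑ p ∈ P, D p * (s p / k) : ℝ) : EReal) := by
    refine energyDensity_eq_of_tendsto ?_
    simp only [energy_add, add_div]
    exact (tendsto_energy_div hGQ fun p _ => hC' p).add (tendsto_energy_div hDP fun p _ => hC' p)
  rw [hX']
  refine le_trans ?_ hY1
  rw [hY2, EReal.coe_le_coe_iff]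
  have hGs : E / k ≤ ∑ p ∈ Q, G p * (s p / k) := by
    have : ∑ p ∈ Q, G p * (s p / k) = (∑ p ∈ Q, H p * s p) / k := by
      rw [Finset.sum_div]
      refine Finset.sum_congr rfl fun p hp => ?_
      simp only [hG, if_pos hp]
      ring
    rw [this]
    exact div_le_div_of_nonneg_right hQ hk'.le
  have hDs : ∑ p ∈ P, D p * μ p - ∑ p ∈ P, D p * (s p / k) ≤ E / (B + 1) * B / k := by
    rw [← Finset.sum_sub_distrib, hB, Finset.mul_sum, Finset.sum_div]
    refine Finset.sum_le_sum fun p hp => ?_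
    have h1 : |k * μ p - s p| ≤ C p + p.width := by
      have h2 := abs_sum_occ_sub_le p hYZ
      have h3 := hC p Z hZ b k
      rw [abs_le] at h2 h3 ⊢
      simp only [hs]
      constructor <;> linarith [h2.1, h2.2, h3.1, h3.2]
    have h4 : |D p| ≤ E / (B + 1) := by
      rw [hD, abs_sub_comm]
      exact (hHP p hp).le
    calc D p * μ p - D p * (s p / k) = D p * (k * μ p - s p) / k := by field_simp
      _ ≤ |D p| * |k * μ p - s p| / k := by
        rw [← abs_mul]
        exact div_le_div_of_nonneg_right (le_abs_self _) hk'.le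
      _ ≤ E / (B + 1) * (C p + p.width) / k := by gcongr
  have hEB : E / (B + 1) * B / k ≤ E / k := by
    refine div_le_div_of_nonneg_right ?_ hk'.le
    rw [div_mul_eq_mul_div, div_le_iff₀ (by positivity)]
    linarith
  linarith
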